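/- A machine is a partial computable function $M\colon 2^{<\omega}\to 2^{<\omega}$ on finite binary strings; it is prefix-free if no string in its domain is a proper prefix of another string in its domain. A prefix-free machine $U$ is universal if it simulates every prefix-free machine with constant overhead: for every prefix-free machine $M$ there is a constant $c$ such that whenever $M(\tau)=\sigma$ there is $\tau'$ with $U(\tau')=\sigma$ and $|\tau'|\le|\tau|+c$. Let $K_U(\sigma)=\min\{|\tau| : U(\tau)=\sigma\}$ and let $R_{K_U}=\{\sigma : K_U(\sigma)\ge|\sigma|\}$ be the set of random strings with respect to $U$. We write $A\le_{\mathrm{tt}}B$ if $A$ is truth-table reducible to $B$: there is a computable function assigning to each input $a$ a finite list of queries $b_1,\dots,b_k$ and a truth table on $k$ inputs, such that $a\in A$ if and only if the table gives the value $1$ on the row $(B(b_1),\dots,B(b_k))$. Theorem. For any two universal prefix-free machines $U_1$ and $U_2$ there is a noncomputable computably enumerable set $A\subseteq\mathbb{N}$ such that $A\le_{\mathrm{tt}}R_{K_{U_1}}$ and $A\le_{\mathrm{tt}}R_{K_{U_2}}$. Consequently $R_{K_{U_1}}$ and $R_{K_{U_2}}$ do not form a tt-minimal pair, that is, it is not the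 case that both are noncomputable and every set $A\subseteq\mathbb{N}$ that is tt-reducible to both of them is computable. -/

import Mathlib

namespace RandomStrings

/-- A prefix-free machine: a partial computable function on finite binary strings
such that no string in its domain is a proper prefix of another one. -/
structure IsPrefixFreeMachine (M : List Bool →. List Bool) : Prop where
  partrec : Partrec M
  prefixFree : ∀ σ τ : List Bool, (M σ).Dom → (M τ).Dom → σ <+: τ → σ = τ

/-- A universal prefix-free machine: a prefix-free machine that simulates every prefix-free
machine `M`, in that every `M`-description is matched by a `U`-description of the same string
which is longer by at most a constant depending only on `M`.  (Equivalently, `K_U` is minimal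
up to an additive constant.  Machines `U` which satisfy `U (ρ_M ++ τ) = M τ` for fixed coding
strings `ρ_M` are a special case, see `IsUniversal.of_coding`.) -/
structure IsUniversal (U : List Bool →. List Bool) : Prop where
  machine : IsPrefixFreeMachine U
  simulates : ∀ M : List Bool →. List Bool, IsPrefixFreeMachine M →
    ∃ c : ℕ, ∀ τ σ : List Bool, σ ∈ M τ → ∃ τ' : List Bool, σ ∈ U τ' ∧ τ'.length ≤ τ.length + c

theorem IsUniversal.of_coding {U : List Bool →. List Bool} (hU : IsPrefixFreeMachine U)
    (h : ∀ M : List Bool →. List Bool, IsPrefixFreeMachine M →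
      ∃ ρ : List Bool, ∀ τ : List Bool, U (ρ ++ τ) = M τ) : IsUniversal U := by
  refine ⟨hU, fun M hM => ?_⟩
  obtain ⟨ρ, hρ⟩ := h M hM
  refine ⟨ρ.length, fun τ σ hσ => ⟨ρ ++ τ, by rw [hρ]; exact hσ, ?_⟩⟩
  rw [List.length_append, add_comm]

/-- The complexity `K_M(σ)`: the least length of an `M`-description of `σ`
(`⊤` if there is none, which does not happen when `M` is universal). -/
noncomputable def K (M : List Bool →. List Bool) (σ : List Bool) : ℕ∞ :=
  ⨅ (τ : List Bool) (_ : σ ∈ M τ), (τ.length : ℕ∞)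

/-- The set `R_{K_U}` of strings that are random with respect to `U`. -/
def randomStrings (U : List Bool →. List Bool) : Set (List Bool) :=
  {σ | (σ.length : ℕ∞) ≤ K U σ}

open Classical in
/-- Truth-table reducibility `A ≤_tt B`: there are computable functions which assign to every
input `a` a finite list `queries a` of oracle queries and a truth table, given by the finite list
`rows a` of those rows (sequences of answers) on which the output is `1`, such that `a ∈ A` iff
the row of true answers about membership in `B` is one of them. -/
def TTReducible {α β : Type*} [Primcodable α] [Primcodable β] (A : Set α) (B : Set β) : Prop :=
  ∃ (queries : α → List β) (rows : α → List (List Bool)),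
    Computable queries ∧ Computable rows ∧
      ∀ a : α, a ∈ A ↔ (queries a).map (fun b => decide (b ∈ B)) ∈ rows a

/-- `B₁` and `B₂` form a tt-minimal pair: both are noncomputable, and every set that is
tt-reducible to both is computable. -/
def TTMinimalPair {β : Type*} [Primcodable β] (B₁ B₂ : Set β) : Prop :=
  ¬ ComputablePred (fun b => b ∈ B₁) ∧ ¬ ComputablePred (fun b => b ∈ B₂) ∧
    ∀ A : Set ℕ, TTReducible A B₁ → TTReducible A B₂ → ComputablePred (fun n => n ∈ A)

end RandomStrings

namespace RandomStrings

open Encodable Filter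

/-! ### Kraft's inequality for prefix-free sets -/

/-! Let T(x) be the number of strings of length x nonrandom for `U₁` plus the number nonrandom for
`U₂`. Kraft's inequality bounds the sum of T(x)·2^(-x) by 1, so the lengths with T(x) ≥
2^(x+4)/2^(log x) (eventually `Large`) have total weight, in terms of 2^(-log x), at most 1/16. The
moment x becomes `Large` can be enumerated, so these events receive prefix-free codewords of length
log x + 1 computably. A machine can then react to the event by compressing `gap a x`, about 2^(x -
log x) up to a constant factor, further strings of length x. By universality both counts must rise
by `gap a x` after the event (`exists_growth`).

On the lengths that never become `Large`, T(x) is bounded by a constant multiple of the gap. Hence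
some level q satisfies T(x) ≥ q·gap for infinitely many such x and T(x) < (q+1)·gap for almost all
of them (`exists_level`). Let A consist of the pairs (x, t) with x large enough, x not yet `Large`
at stage t, at least q·gap strings enumerated by then, and x `Large` later. For (x, t) in A each of
the two counts still grows by a gap; if x never becomes `Large`, even their sum grows by less. So
either count alone decides A, by a threshold truth table (`ttReducible_of_total`).

A is c.e. by definition. Were it computable, one could search for arbitrarily long x that never
become `Large`; but a length computed from a small parameter has too many compressible strings
(`exists_large_total`). -/

theorem uniquelyDecodable_of_prefixFree {S : Finset (List Bool)} (h0 : [] ∉ S)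
    (h : ∀ σ ∈ S, ∀ τ ∈ S, σ <+: τ → σ = τ) :
    InformationTheory.UniquelyDecodable (S : Set (List Bool)) := by
  intro L₁
  induction L₁ with
  | nil =>
    intro L₂ _ h₂ he
    cases L₂ with
    | nil => rfl
    | cons b L₂ =>
      have hb : b = [] := by simp at he; exact he.1
      exact absurd (hb ▸ h₂ b (by simp)) h0
  | cons a L₁ ih =>
    intro L₂ h₁ h₂ he
    cases L₂ with
    | nil =>
      have ha : a = [] := by simp at he; exact he.1
      exact absurd (ha ▸ h₁ a (by simp)) h0
    | cons b L₂ =>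
      simp only [List.flatten_cons] at he
      have ha : a ∈ S := h₁ a (by simp)
      have hb : b ∈ S := h₂ b (by simp)
      have hab : a = b := by
        rcases List.prefix_or_prefix_of_prefix
          (show a <+: a ++ L₁.flatten from List.prefix_append _ _)
          (show b <+: a ++ L₁.flatten from he ▸ List.prefix_append _ _) with hp | hp
        · exact h a ha b hb hp
        · exact (h b hb a ha hp).symm
      subst hab
      rw [ih L₂ (fun w hw => h₁ w (by simp [hw])) (fun w hw => h₂ w (by simp [hw]))
        (List.append_cancel_left he)]

theorem kraft_of_prefixFree {S : Finset (List Bool)}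
    (h : ∀ σ ∈ S, ∀ τ ∈ S, σ <+: τ → σ = τ) :
    ∑ τ ∈ S, (1 / 2 : ℝ) ^ τ.length ≤ 1 := by
  -- The set {[]} is prefix-free but not uniquely decodable, so it is treated apart.
  by_cases h0 : [] ∈ S
  · have : S = {[]} := by
      ext τ
      simp only [Finset.mem_singleton]
      exact ⟨fun hτ => (h [] h0 τ hτ List.nil_prefix).symm, fun hτ => hτ ▸ h0⟩
    simp [this]
  · simpa using InformationTheory.kraft_mcmillan_inequality (uniquelyDecodable_of_prefixFree h0 h)

/-! ### Finite lists of strings -/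

/-- The list of all binary strings of length `n`. -/
def allStrings : ℕ → List (List Bool)
  | 0 => [[]]
  | n + 1 => (allStrings n).map (List.cons false) ++ (allStrings n).map (List.cons true)

theorem mem_allStrings {n : ℕ} {σ : List Bool} : σ ∈ allStrings n ↔ σ.length = n := by
  induction n generalizing σ with
  | zero => simp [allStrings]
  | succ n ih =>
    cases σ with
    | nil => simp [allStrings]
    | cons b σ => cases b <;> simp [allStrings, ih]

theorem nodup_allStrings (n : ℕ) : (allStrings n).Nodup := by
  induction n with
  | zero => simp [allStrings]
  | succ n ih =>
    rw [allStrings, List.nodup_append]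
    refine ⟨ih.map (List.cons_injective), ih.map (List.cons_injective), ?_⟩
    simp only [List.mem_map]
    rintro _ ⟨a, -, rfl⟩ _ ⟨b, -, rfl⟩ h
    simp at h

@[simp] theorem length_allStrings (n : ℕ) : (allStrings n).length = 2 ^ n := by
  induction n with
  | zero => simp [allStrings]
  | succ n ih => simp [allStrings, ih, pow_succ, mul_two]

theorem primrec_allStrings : Primrec allStrings := by
  have h : Primrec (Nat.rec (motive := fun _ => List (List Bool)) [[]]
      fun _ L => L.map (List.cons false) ++ L.map (List.cons true)) := by
    refine Primrec.nat_rec₁ _ (Primrec.list_append.comp ?_ ?_)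
    · exact Primrec.list_map Primrec.snd (Primrec.list_cons.comp (Primrec.const _) Primrec.snd)
    · exact Primrec.list_map Primrec.snd (Primrec.list_cons.comp (Primrec.const _) Primrec.snd)
  refine h.of_eq fun n => ?_
  induction n with
  | zero => rfl
  | succ n ih => simp only [allStrings, ← ih]

theorem primrec_two_pow : Primrec (fun n : ℕ => 2 ^ n) := by
  have h : Primrec (Nat.rec (motive := fun _ => ℕ) 1 fun _ y => 2 * y) :=
    Primrec.nat_rec₁ _ (Primrec.nat_double.comp Primrec.snd : Primrec fun p : ℕ × ℕ => 2 * p.2)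
  refine h.of_eq fun n => ?_
  induction n with
  | zero => rfl
  | succ n ih => simp only [ih]; ring

theorem primrec_log : Primrec (Nat.log 2) := by
  have h : Primrec fun x : ℕ => x.findGreatest fun k => 2 ^ k ≤ x :=
    Primrec.nat_findGreatest Primrec.id
      (Primrec.nat_le.comp (primrec_two_pow.comp Primrec.snd) Primrec.fst)
  refine h.of_eq fun x => ?_
  rcases Nat.eq_zero_or_pos x with rfl | hx
  · rfl
  rw [Nat.findGreatest_eq_iff]
  refine ⟨Nat.log_le_self 2 x, fun _ => Nat.pow_log_le_self 2 hx.ne', fun n hn _ hle => ?_⟩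
  have := (Nat.le_log_iff_pow_le (by norm_num) hx.ne').2 hle
  omega

theorem primrec_replicate {α : Type*} [Primcodable α] (b : α) :
    Primrec fun n : ℕ => List.replicate n b := by
  refine (Primrec.list_map (g := fun _ _ => b) Primrec.list_range (Primrec.const b)).of_eq
    fun n => ?_
  simp

/-- The `ℓ` lowest binary digits of `v`, most significant digit first. -/
def binary (ℓ v : ℕ) : List Bool := (List.range ℓ).map fun i => v.testBit (ℓ - 1 - i)

@[simp] theorem length_binary (ℓ v : ℕ) : (binary ℓ v).length = ℓ := by simp [binary]

theorem primrec_testBit : Primrec₂ Nat.testBit := by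
  have h : PrimrecRel fun v i : ℕ => v / 2 ^ i % 2 = 1 :=
    Primrec.eq.comp (Primrec.nat_mod.comp
      (Primrec.nat_div.comp Primrec.fst (primrec_two_pow.comp Primrec.snd)) (Primrec.const 2))
      (Primrec.const 1)
  exact h.decide.of_eq fun v i => (Nat.testBit_eq_decide_div_mod_eq).symm

theorem primrec_binary : Primrec₂ binary := by
  refine Primrec.list_map (Primrec.list_range.comp Primrec.fst) ?_
  exact primrec_testBit.comp (Primrec.snd.comp Primrec.fst)
    (Primrec.nat_sub.comp (Primrec.nat_sub.comp (Primrec.fst.comp Primrec.fst) (Primrec.const 1))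
      Primrec.snd)

/-- Prefixes correspond to nested dyadic intervals; this is how disjointness of intervals will give
prefix-freeness of codewords. -/
theorem eq_div_of_binary_prefix {ℓ ℓ' v v' : ℕ} (hv : v < 2 ^ ℓ) (hv' : v' < 2 ^ ℓ')
    (h : binary ℓ v <+: binary ℓ' v') : v = v' / 2 ^ (ℓ' - ℓ) := by
  have hle : ℓ ≤ ℓ' := by simpa using h.length_le
  refine Nat.eq_of_testBit_eq fun i => ?_
  rw [Nat.testBit_div_two_pow]
  by_cases hi : i < ℓ
  · rw [List.prefix_iff_getElem] at h
    obtain ⟨_, h⟩ := h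
    have := h (ℓ - 1 - i) (by simp; omega)
    simp only [binary, List.getElem_map, List.getElem_range] at this
    rw [show ℓ - 1 - (ℓ - 1 - i) = i by omega,
      show ℓ' - 1 - (ℓ - 1 - i) = i + (ℓ' - ℓ) by omega] at this
    exact this
  · rw [Nat.testBit_lt_two_pow (hv.trans_le (Nat.pow_le_pow_right (by norm_num) (not_lt.1 hi))),
      Nat.testBit_lt_two_pow (hv'.trans_le (Nat.pow_le_pow_right (by norm_num) (by omega)))]

theorem binary_injOn {ℓ v v' : ℕ} (hv : v < 2 ^ ℓ) (hv' : v' < 2 ^ ℓ)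
    (h : binary ℓ v = binary ℓ v') : v = v' := by
  simpa using eq_div_of_binary_prefix hv hv' (h ▸ List.prefix_rfl)

/-- The header 1^a 0 is self-delimiting, so one machine can serve all parameters a at once. Since a
can be chosen after the simulation constant is known, no recursion theorem is needed. -/
theorem replicate_prefix {a a' : ℕ} {r r' : List Bool}
    (h : List.replicate a true ++ false :: r <+: List.replicate a' true ++ false :: r') :
    a = a' ∧ r <+: r' := by
  induction a generalizing a' with
  | zero =>
    cases a' with
    | zero => simpa using h
    | succ a' => simp [List.replicate_succ] at h
  | succ a ih =>
    cases a' with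
    | zero => simp [List.replicate_succ] at h
    | succ a' =>
      simp only [List.replicate_succ, List.cons_append, List.cons_prefix_cons, true_and] at h
      simpa using ih h

/-! ### Machines given by an enumeration of their graphs -/

/-- To compute M(v), search for an index p at which `D` lists v. The hypothesis `hpf` makes the
listed graph both single-valued and prefix-free in its domain. -/
theorem exists_machine {P : Type*} [Primcodable P] (D : P → Option (List Bool × List Bool))
    (hD : Computable D)
    (hpf : ∀ p p' v o v' o', D p = some (v, o) → D p' = some (v', o') → v <+: v' →
      v = v' ∧ o = o') :
    ∃ M : List Bool →. List Bool, IsPrefixFreeMachine M ∧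
      ∀ p v o, D p = some (v, o) → o ∈ M v := by
  let F : List Bool → ℕ → Option (List Bool) := fun v n =>
    (decode (α := P) n).bind fun p => (D p).bind fun w => if w.1 = v then some w.2 else none
  have hF : Computable₂ F := by
    refine Computable.option_bind (Computable.decode.comp Computable.snd) ?_
    refine Computable.option_bind (hD.comp Computable.snd) ?_
    have hc : PrimrecPred fun q : (((List Bool × ℕ) × P) × (List Bool × List Bool)) =>
        q.2.1 = q.1.1.1 :=
      Primrec.eq.comp (Primrec.fst.comp Primrec.snd)
        (Primrec.fst.comp (Primrec.fst.comp Primrec.fst))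
    exact (Primrec.ite hc (Primrec.option_some.comp (Primrec.snd.comp Primrec.snd))
      (Primrec.const none)).to_comp
  have key : ∀ v n o, o ∈ F v n → ∃ p, D p = some (v, o) := by
    intro v n o ho
    simp only [F, Option.mem_def, Option.bind_eq_some_iff] at ho
    obtain ⟨p, -, w, hw, ho⟩ := ho
    split_ifs at ho with hv
    · exact ⟨p, by rw [hw, ← hv, ← Option.some.inj ho]⟩
  refine ⟨fun v => Nat.rfindOpt (F v), ⟨Partrec.rfindOpt hF, ?_⟩, ?_⟩
  · intro σ τ hσ hτ hp
    obtain ⟨n, o, ho⟩ := Nat.rfindOpt_dom.1 hσ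
    obtain ⟨n', o', ho'⟩ := Nat.rfindOpt_dom.1 hτ
    obtain ⟨p, hp₁⟩ := key _ _ _ ho
    obtain ⟨p', hp₂⟩ := key _ _ _ ho'
    exact (hpf _ _ _ _ _ _ hp₁ hp₂ hp).1
  · intro p v o hp
    have hd : (Nat.rfindOpt (F v)).Dom :=
      Nat.rfindOpt_dom.2 ⟨encode p, o, by simp [F, hp]⟩
    obtain ⟨o', ho'⟩ := Part.dom_iff_mem.1 hd
    obtain ⟨n, hn⟩ := Nat.rfindOpt_spec ho'
    obtain ⟨p', hp'⟩ := key _ _ _ hn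
    exact (hpf _ _ _ _ _ _ hp hp' List.prefix_rfl).2 ▸ ho'

/-! ### Nonrandom strings and their enumeration -/

theorem notMem_randomStrings {U : List Bool →. List Bool} {σ : List Bool} :
    σ ∉ randomStrings U ↔ ∃ τ, σ ∈ U τ ∧ τ.length < σ.length := by
  simp [randomStrings, K]

theorem exists_stages {U : List Bool →. List Bool} (hU : Partrec U) :
    ∃ f : List Bool → ℕ → Bool, Primrec₂ f ∧ (∀ σ s t, s ≤ t → f σ s = true → f σ t = true) ∧
      (∀ σ, f σ 0 = false) ∧ ∀ σ, (∃ s, f σ s = true) ↔ σ ∉ randomStrings U := by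
  classical
  obtain ⟨c, hc⟩ := Nat.Partrec.Code.exists_code.1 hU
  let R : ℕ → List Bool × ℕ → Prop := fun n q =>
    Nat.Partrec.Code.evaln q.2 c n = some (encode q.1) ∧
      ((decode (α := List Bool) n).map List.length).getD 0 < q.1.length
  have hR : PrimrecRel R := by
    refine PrimrecPred.and ?_ ?_
    · exact Primrec.eq.comp (Nat.Partrec.Code.primrec_evaln.comp
        (((Primrec.snd.comp Primrec.snd).pair (Primrec.const c)).pair Primrec.fst))
        (Primrec.option_some.comp (Primrec.encode.comp (Primrec.fst.comp Primrec.snd)))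
    · exact Primrec.nat_lt.comp (Primrec.option_getD.comp
        (Primrec.option_map (Primrec.decode.comp Primrec.fst)
          (Primrec.list_length.comp Primrec.snd)) (Primrec.const 0))
        (Primrec.list_length.comp (Primrec.fst.comp Primrec.snd))
  have hP : PrimrecPred fun q : List Bool × ℕ => ∃ n ∈ List.range q.2, R n q :=
    hR.exists_mem_list.comp (Primrec.list_range.comp Primrec.snd) Primrec.id
  refine ⟨fun σ s => decide (∃ n ∈ List.range s, R n (σ, s)), hP.decide, ?_, ?_, ?_⟩
  · intro σ s t hst h
    simp only [decide_eq_true_eq, List.mem_range] at h ⊢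
    obtain ⟨n, hn, h₁, h₂⟩ := h
    exact ⟨n, hn.trans_le hst, Nat.Partrec.Code.evaln_mono hst h₁, h₂⟩
  · simp
  · intro σ
    have heval : ∀ n, encode σ ∈ c.eval n ↔ ∃ τ, decode (α := List Bool) n = some τ ∧ σ ∈ U τ := by
      intro n
      rw [hc]
      simp only [Part.mem_bind_iff, Part.mem_coe, Option.mem_def, Part.mem_map_iff]
      simp
    rw [notMem_randomStrings]
    simp only [decide_eq_true_eq, List.mem_range]
    constructor
    · rintro ⟨s, n, -, h₁, h₂⟩
      obtain ⟨τ, hτ, hσ⟩ := (heval n).1 (Nat.Partrec.Code.evaln_sound h₁)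
      exact ⟨τ, hσ, by simpa [hτ] using h₂⟩
    · rintro ⟨τ, hσ, hlt⟩
      obtain ⟨k, hk⟩ := Nat.Partrec.Code.evaln_complete.1
        ((heval (encode τ)).2 ⟨τ, by simp, hσ⟩)
      -- Restricting stage s to inputs below s loses nothing: `evaln` with bound k halts only on
      -- inputs below k.
      exact ⟨k, encode τ, Nat.Partrec.Code.evaln_bound hk, hk, by simpa using hlt⟩

/-! ### Counting nonrandom strings -/

open Classical in
/-- The number of strings of length `x` that are not random with respect to `U`. -/
noncomputable def total (U : List Bool →. List Bool) (x : ℕ) : ℕ :=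
  (allStrings x).countP fun σ => decide (σ ∉ randomStrings U)

/-- The number of strings of length `x` that have been enumerated by stage `t`. -/
def count (g : List Bool → ℕ → Bool) (x t : ℕ) : ℕ := (allStrings x).countP fun σ => g σ t

theorem countP_allStrings (x : ℕ) (p : List Bool → Bool) :
    (allStrings x).countP p = ((allStrings x).toFinset.filter fun σ => p σ = true).card := by
  rw [List.countP_eq_length_filter, ← List.toFinset_filter,
    List.toFinset_card_of_nodup ((nodup_allStrings x).filter _)]

theorem primrec_count {g : List Bool → ℕ → Bool} (hg : Primrec₂ g) : Primrec₂ (count g) := by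
  have hR : PrimrecRel fun (σ : List Bool) (t : ℕ) => g σ t = true :=
    Primrec.eq.comp hg (Primrec.const true)
  refine (Primrec.list_length.comp (hR.listFilter.comp
    (primrec_allStrings.comp Primrec.fst) Primrec.snd)).of_eq fun p => ?_
  simp [count, List.countP_eq_length_filter]

/-- `g` enumerates the strings that are not random with respect to `U`. -/
structure Enumerates (g : List Bool → ℕ → Bool) (U : List Bool →. List Bool) : Prop where
  primrec : Primrec₂ g
  mono : ∀ σ s t, s ≤ t → g σ s = true → g σ t = true
  zero : ∀ σ, g σ 0 = false
  spec : ∀ σ, (∃ s, g σ s = true) ↔ σ ∉ randomStrings U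

namespace Enumerates

variable {g : List Bool → ℕ → Bool} {U : List Bool →. List Bool}

theorem count_zero (hg : Enumerates g U) (x : ℕ) : count g x 0 = 0 := by
  simp [count, hg.zero]

theorem count_mono (hg : Enumerates g U) (x : ℕ) {s t : ℕ} (hst : s ≤ t) :
    count g x s ≤ count g x t :=
  List.countP_mono_left fun σ _ h => hg.mono σ s t hst h

theorem count_le_total (hg : Enumerates g U) (x t : ℕ) : count g x t ≤ total U x := by
  classical
  exact List.countP_mono_left fun σ _ h => by simpa using (hg.spec σ).1 ⟨t, h⟩

theorem exists_count_eq_total (hg : Enumerates g U) (x : ℕ) :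
    ∃ t₀, ∀ t, t₀ ≤ t → count g x t = total U x := by
  classical
  have : ∀ σ, ∃ t, σ ∉ randomStrings U → g σ t = true := fun σ => by
    by_cases h : σ ∉ randomStrings U
    · exact ((hg.spec σ).2 h).imp fun _ h _ => h
    · exact ⟨0, fun h' => absurd h' h⟩
  choose t ht using this
  refine ⟨(allStrings x).toFinset.sup t, fun t' ht' => le_antisymm (hg.count_le_total x t') ?_⟩
  refine List.countP_mono_left fun σ hσ h => ?_
  exact hg.mono σ _ _ ((Finset.le_sup (f := t) (by simpa using hσ)).trans ht')
    (ht σ (by simpa using h))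

end Enumerates

/-- Nonrandom strings have distinct descriptions, which form a prefix-free set. Each is at least one
bit shorter than its string, which improves Kraft's bound 1 to 1/2. -/
theorem sum_total_le {U : List Bool →. List Bool} (hU : IsPrefixFreeMachine U) (F : Finset ℕ) :
    ∑ x ∈ F, (total U x : ℝ) * (1 / 2) ^ x ≤ 1 / 2 := by
  classical
  let T : ℕ → Finset (List Bool) := fun x =>
    (allStrings x).toFinset.filter fun σ => σ ∉ randomStrings U
  have hT : ∀ {x σ}, σ ∈ T x ↔ σ.length = x ∧ σ ∉ randomStrings U := by
    intro x σ; simp [T, mem_allStrings]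
  have hcard : ∀ x, total U x = (T x).card := fun x => by
    simp only [total, countP_allStrings, decide_eq_true_eq, T]
  have hdisj : (F : Set ℕ).PairwiseDisjoint T := by
    intro x _ y _ hxy
    rw [Function.onFun, Finset.disjoint_left]
    intro σ h₁ h₂
    exact hxy ((hT.1 h₁).1.symm.trans (hT.1 h₂).1)
  have h₁ : ∑ x ∈ F, (total U x : ℝ) * (1 / 2) ^ x
      = ∑ σ ∈ F.biUnion T, (1 / 2 : ℝ) ^ σ.length := by
    rw [Finset.sum_biUnion hdisj]
    refine Finset.sum_congr rfl fun x _ => ?_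
    rw [Finset.sum_congr rfl fun σ hσ => by rw [(hT.1 hσ).1], Finset.sum_const, hcard,
      nsmul_eq_mul]
  have hex : ∀ σ, ∃ τ, σ ∉ randomStrings U → σ ∈ U τ ∧ τ.length < σ.length := fun σ => by
    by_cases h : σ ∉ randomStrings U
    · exact (notMem_randomStrings.1 h).imp fun _ h _ => h
    · exact ⟨[], fun h' => absurd h' h⟩
  choose d hd using hex
  have hmem : ∀ σ ∈ F.biUnion T, σ ∉ randomStrings U := fun σ hσ => by
    obtain ⟨x, -, hx⟩ := Finset.mem_biUnion.1 hσ
    exact (hT.1 hx).2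
  have hinj : Set.InjOn d (F.biUnion T : Finset (List Bool)) := by
    intro σ hσ σ' hσ' he
    have h := (hd σ (hmem σ hσ)).1
    rw [he] at h
    exact Part.mem_unique h (hd σ' (hmem σ' hσ')).1
  have h₂ : ∑ τ ∈ (F.biUnion T).image d, (1 / 2 : ℝ) ^ τ.length ≤ 1 := by
    refine kraft_of_prefixFree fun τ hτ τ' hτ' hp => ?_
    obtain ⟨σ, hσ, rfl⟩ := Finset.mem_image.1 hτ
    obtain ⟨σ', hσ', rfl⟩ := Finset.mem_image.1 hτ'
    exact hU.prefixFree _ _ (Part.dom_iff_mem.2 ⟨_, (hd σ (hmem σ hσ)).1⟩)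
      (Part.dom_iff_mem.2 ⟨_, (hd σ' (hmem σ' hσ')).1⟩) hp
  rw [Finset.sum_image hinj] at h₂
  rw [h₁]
  calc ∑ σ ∈ F.biUnion T, (1 / 2 : ℝ) ^ σ.length
      ≤ ∑ σ ∈ F.biUnion T, (1 / 2) * (1 / 2 : ℝ) ^ (d σ).length := by
        refine Finset.sum_le_sum fun σ hσ => ?_
        rw [← pow_succ']
        exact pow_le_pow_of_le_one (by norm_num) (by norm_num) (hd σ (hmem σ hσ)).2
    _ = (1 / 2) * ∑ σ ∈ F.biUnion T, (1 / 2 : ℝ) ^ (d σ).length := by rw [Finset.mul_sum]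
    _ ≤ 1 / 2 := by linarith

theorem two_mul_total_le {U : List Bool →. List Bool} (hU : IsPrefixFreeMachine U) (x : ℕ) :
    2 * total U x ≤ 2 ^ x := by
  have h := sum_total_le hU {x}
  rw [Finset.sum_singleton, one_div_pow, mul_one_div, div_le_iff₀ (by positivity)] at h
  have : (2 * total U x : ℝ) ≤ 2 ^ x := by linarith
  exact_mod_cast this

/-! ### Lengths with many nonrandom strings -/

/-- At stage `t`, the proportion of enumerated strings of length `x` exceeds a threshold which is
of the order of `1 / x`. -/
abbrev Large (h : ℕ → ℕ → ℕ) (x t : ℕ) : Prop := 2 ^ (x + 4) ≤ h x t * 2 ^ Nat.log 2 x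

/-- The pair coded by `s` consists of a length and the last stage at which it is not `Large`. -/
abbrev Enters (h : ℕ → ℕ → ℕ) (s : ℕ) : Prop :=
  Large h s.unpair.1 (s.unpair.2 + 1) ∧ ¬ Large h s.unpair.1 s.unpair.2

theorem primrecRel_large {h : ℕ → ℕ → ℕ} (hh : Primrec₂ h) : PrimrecRel (Large h) :=
  Primrec.nat_le.comp
    (primrec_two_pow.comp (Primrec.nat_add.comp Primrec.fst (Primrec.const 4)))
    (Primrec.nat_mul.comp hh (primrec_two_pow.comp (primrec_log.comp Primrec.fst)))

theorem primrecPred_enters {h : ℕ → ℕ → ℕ} (hh : Primrec₂ h) : PrimrecPred (Enters h) := by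
  have h₁ : Primrec fun s : ℕ => s.unpair.1 := Primrec.fst.comp Primrec.unpair
  have h₂ : Primrec fun s : ℕ => s.unpair.2 := Primrec.snd.comp Primrec.unpair
  exact PrimrecPred.and ((primrecRel_large hh).comp h₁ (Primrec.succ.comp h₂))
    ((primrecRel_large hh).comp h₁ h₂).not

/-- A computable family of counts that increase with the stage and for which the `Large` lengths
have a small total weight. -/
structure Sparse (h : ℕ → ℕ → ℕ) : Prop where
  primrec : Primrec₂ h
  mono : ∀ x s t, s ≤ t → h x s ≤ h x t
  zero : ∀ x, h x 0 = 0
  sum_le : ∀ F : Finset ℕ, (∀ x ∈ F, ∃ t, Large h x t) →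
    ∑ x ∈ F, (1 / 2 : ℝ) ^ Nat.log 2 x ≤ 1 / 16

/-- A `Large` length contributes at least 16·2^(-log x) to the two Kraft sums, which together are at
most 1. -/
theorem sparse_add {g₁ g₂ : List Bool → ℕ → Bool} {U₁ U₂ : List Bool →. List Bool}
    (hg₁ : Enumerates g₁ U₁) (hg₂ : Enumerates g₂ U₂)
    (hU₁ : IsPrefixFreeMachine U₁) (hU₂ : IsPrefixFreeMachine U₂) :
    Sparse fun x t => count g₁ x t + count g₂ x t where
  primrec := Primrec.nat_add.comp (primrec_count hg₁.primrec) (primrec_count hg₂.primrec)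
  mono x _ _ hst := add_le_add (hg₁.count_mono x hst) (hg₂.count_mono x hst)
  zero x := by simp [hg₁.count_zero, hg₂.count_zero]
  sum_le F hF := by
    have h₁ := sum_total_le hU₁ F
    have h₂ := sum_total_le hU₂ F
    have key : ∀ x ∈ F, 16 * (1 / 2 : ℝ) ^ Nat.log 2 x
        ≤ (total U₁ x : ℝ) * (1 / 2) ^ x + (total U₂ x : ℝ) * (1 / 2) ^ x := by
      intro x hx
      obtain ⟨t, ht⟩ := hF x hx
      have ht' : 2 ^ (x + 4) ≤ (total U₁ x + total U₂ x) * 2 ^ Nat.log 2 x :=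
        ht.trans (Nat.mul_le_mul_right _
          (add_le_add (hg₁.count_le_total x t) (hg₂.count_le_total x t)))
      have hr : (2 : ℝ) ^ (x + 4) ≤ (total U₁ x + total U₂ x) * 2 ^ Nat.log 2 x := by
        exact_mod_cast ht'
      rw [← add_mul, one_div_pow, one_div_pow, mul_one_div, mul_one_div,
        div_le_div_iff₀ (by positivity) (by positivity)]
      calc (16 : ℝ) * 2 ^ x = 2 ^ (x + 4) := by ring
        _ ≤ _ := hr
    have h₃ := Finset.sum_le_sum key
    rw [← Finset.mul_sum, Finset.sum_add_distrib] at h₃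
    linarith

namespace Sparse

variable {h : ℕ → ℕ → ℕ}

theorem large_mono (hh : Sparse h) {x s t : ℕ} (hst : s ≤ t) (hl : Large h x s) : Large h x t :=
  hl.trans (Nat.mul_le_mul_right _ (hh.mono x s t hst))

theorem not_large_zero (hh : Sparse h) (x : ℕ) : ¬ Large h x 0 := by
  simp [Large, hh.zero]

theorem exists_enters (hh : Sparse h) {x t : ℕ} (hl : ¬ Large h x t) (hx : ∃ t, Large h x t) :
    ∃ t', t ≤ t' ∧ Large h x (t' + 1) ∧ ¬ Large h x t' := by
  classical
  have hpos : Nat.find hx ≠ 0 := fun h0 => hh.not_large_zero x (h0 ▸ Nat.find_spec hx)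
  obtain ⟨t', ht'⟩ := Nat.exists_eq_succ_of_ne_zero hpos
  have hspec := Nat.find_spec hx
  rw [ht'] at hspec
  refine ⟨t', ?_, hspec, Nat.find_min hx (by omega)⟩
  by_contra hlt
  exact hl (hh.large_mono (show Nat.find hx ≤ t by omega) (Nat.find_spec hx))

/-- By monotonicity a length enters only once, so sums over events are sums over distinct lengths.
-/
theorem enters_injOn (hh : Sparse h) {s s' : ℕ} (hs : Enters h s) (hs' : Enters h s')
    (he : s.unpair.1 = s'.unpair.1) : s = s' := by
  have aux : ∀ {s s' : ℕ}, Enters h s → Enters h s' → s.unpair.1 = s'.unpair.1 →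
      s'.unpair.2 ≤ s.unpair.2 := by
    intro s s' hs hs' he
    by_contra hlt
    exact hs'.2 (he ▸ hh.large_mono (show s.unpair.2 + 1 ≤ s'.unpair.2 by omega) hs.1)
  rw [← Nat.pair_unpair s, ← Nat.pair_unpair s', he,
    le_antisymm (aux hs' hs he.symm) (aux hs hs' he)]

/-- The 2^J lengths with logarithm J have total weight 1, exceeding the bound 1/16 for `Large`
lengths. -/
theorem exists_not_large (hh : Sparse h) (J : ℕ) :
    ∃ x, Nat.log 2 x = J ∧ ∀ t, ¬ Large h x t := by
  by_contra hcon
  push Not at hcon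
  have hlog : ∀ x ∈ Finset.Ico (2 ^ J) (2 ^ (J + 1)), Nat.log 2 x = J := fun x hx => by
    rw [Finset.mem_Ico] at hx
    exact Nat.log_eq_of_pow_le_of_lt_pow hx.1 hx.2
  have := hh.sum_le (Finset.Ico (2 ^ J) (2 ^ (J + 1))) fun x hx => hcon x (hlog x hx)
  rw [Finset.sum_congr rfl fun x hx => by rw [hlog x hx], Finset.sum_const, Nat.card_Ico,
    show 2 ^ (J + 1) - 2 ^ J = 2 ^ J by rw [pow_succ]; omega, nsmul_eq_mul] at this
  push_cast at this
  rw [← mul_pow] at this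
  norm_num at this

end Sparse

/-! ### Prefix-free codewords for the entering events -/

/-- The accumulated weight of the entering events before `s`, scaled by `2 ^ s`. -/
def weight (h : ℕ → ℕ → ℕ) : ℕ → ℕ
  | 0 => 0
  | s + 1 => 2 * weight h s + if Enters h s then 2 ^ (s + 1 - Nat.log 2 s.unpair.1) else 0

/-- The numerical value of the codeword of the event `s`. -/
def codeValue (h : ℕ → ℕ → ℕ) (s : ℕ) : ℕ :=
  weight h s * 2 ^ (Nat.log 2 s.unpair.1 + 1) / 2 ^ s + 1

/-- The codeword of the event `s`. -/
def codeword (h : ℕ → ℕ → ℕ) (s : ℕ) : List Bool :=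
  binary (Nat.log 2 s.unpair.1 + 1) (codeValue h s)

theorem primrec_weight {h : ℕ → ℕ → ℕ} (hh : Primrec₂ h) : Primrec (weight h) := by
  have hlog : Primrec fun s : ℕ => Nat.log 2 s.unpair.1 :=
    primrec_log.comp (Primrec.fst.comp Primrec.unpair)
  have h₁ : Primrec fun s : ℕ => if Enters h s then 2 ^ (s + 1 - Nat.log 2 s.unpair.1) else 0 :=
    Primrec.ite (primrecPred_enters hh)
      (primrec_two_pow.comp (Primrec.nat_sub.comp Primrec.succ hlog)) (Primrec.const 0)
  have h₂ : Primrec₂ fun s w : ℕ =>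
      2 * w + if Enters h s then 2 ^ (s + 1 - Nat.log 2 s.unpair.1) else 0 :=
    Primrec.nat_add.comp (Primrec.nat_double.comp Primrec.snd) (h₁.comp Primrec.fst)
  refine (Primrec.nat_rec₁ 0 h₂).of_eq fun s => ?_
  induction s with
  | zero => rfl
  | succ s ih => simp only [weight, ← ih]

theorem primrec_codeword {h : ℕ → ℕ → ℕ} (hh : Primrec₂ h) : Primrec (codeword h) := by
  have hlog : Primrec fun s : ℕ => Nat.log 2 s.unpair.1 + 1 :=
    Primrec.succ.comp (primrec_log.comp (Primrec.fst.comp Primrec.unpair))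
  refine primrec_binary.comp hlog (Primrec.succ.comp (Primrec.nat_div.comp
    (Primrec.nat_mul.comp (primrec_weight hh) (primrec_two_pow.comp hlog)) primrec_two_pow))

theorem weight_eq_sum (h : ℕ → ℕ → ℕ) (s : ℕ) : (weight h s : ℝ) / 2 ^ s
    = ∑ r ∈ (Finset.range s).filter (Enters h), (1 / 2 : ℝ) ^ Nat.log 2 r.unpair.1 := by
  induction s with
  | zero => simp [weight]
  | succ s ih =>
    -- This keeps the truncated exponent in `weight` exact.
    have hlog : Nat.log 2 s.unpair.1 ≤ s + 1 :=
      (Nat.log_le_self _ _).trans ((Nat.unpair_left_le s).trans (Nat.le_succ s))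
    rw [Finset.sum_filter, Finset.sum_range_succ, ← Finset.sum_filter, ← ih, weight]
    push_cast
    rw [add_div, pow_succ' (2 : ℝ) s, mul_div_mul_left _ _ (two_ne_zero), ← pow_succ']
    congr 1
    split_ifs
    · rw [one_div_pow, div_eq_div_iff (by positivity) (by positivity), one_mul, ← pow_add,
        Nat.sub_add_cancel hlog]
    · simp

namespace Sparse

variable {h : ℕ → ℕ → ℕ}

theorem weight_le (hh : Sparse h) (s : ℕ) : (weight h s : ℝ) / 2 ^ s ≤ 1 := by
  rw [weight_eq_sum]
  have hinj : Set.InjOn (fun r : ℕ => r.unpair.1)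
      ((Finset.range s).filter (Enters h) : Finset ℕ) := by
    intro r hr r' hr' he
    simp only [Finset.coe_filter, Set.mem_ofPred_eq] at hr hr'
    exact hh.enters_injOn hr.2 hr'.2 he
  have := hh.sum_le (((Finset.range s).filter (Enters h)).image fun r => r.unpair.1) (by
    intro x hx
    obtain ⟨r, hr, rfl⟩ := Finset.mem_image.1 hx
    exact ⟨_, (Finset.mem_filter.1 hr).2.1⟩)
  rw [Finset.sum_image hinj] at this
  linarith

end Sparse

theorem weight_mono (h : ℕ → ℕ → ℕ) {s s' : ℕ} (hs : s ≤ s') :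
    (weight h s : ℝ) / 2 ^ s ≤ (weight h s' : ℝ) / 2 ^ s' := by
  rw [weight_eq_sum, weight_eq_sum]
  exact Finset.sum_le_sum_of_subset_of_nonneg
    (Finset.filter_subset_filter _ (Finset.range_mono hs)) fun _ _ _ => by positivity

/-- Event s owns the interval between the accumulated weights before and after it, of length 2^(-log
x), twice the dyadic step for codewords of length log x + 1. Rounding its left end down and adding
one step gives a dyadic interval inside it; this lemma and the next bound the two ends. -/
theorem weight_lt_codeValue (h : ℕ → ℕ → ℕ) (s : ℕ) :
    (weight h s : ℝ) / 2 ^ s < codeValue h s / 2 ^ (Nat.log 2 s.unpair.1 + 1) := by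
  rw [div_lt_div_iff₀ (by positivity) (by positivity)]
  have := Nat.lt_mul_div_succ (weight h s * 2 ^ (Nat.log 2 s.unpair.1 + 1))
    (show 0 < 2 ^ s by positivity)
  rw [mul_comm (2 ^ s)] at this
  exact_mod_cast this

theorem codeValue_add_one_le {h : ℕ → ℕ → ℕ} {s : ℕ} (hs : Enters h s) :
    ((codeValue h s : ℝ) + 1) / 2 ^ (Nat.log 2 s.unpair.1 + 1)
      ≤ (weight h (s + 1) : ℝ) / 2 ^ (s + 1) := by
  have h₁ : (weight h (s + 1) : ℝ) / 2 ^ (s + 1)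
      = (weight h s : ℝ) / 2 ^ s + 2 / 2 ^ (Nat.log 2 s.unpair.1 + 1) := by
    rw [weight_eq_sum, weight_eq_sum, Finset.sum_filter, Finset.sum_range_succ,
      ← Finset.sum_filter, if_pos hs, one_div_pow]
    congr 1
    rw [pow_succ]
    field_simp
  have h₂ := Nat.div_mul_le_self (weight h s * 2 ^ (Nat.log 2 s.unpair.1 + 1)) (2 ^ s)
  have h₃ : ((weight h s * 2 ^ (Nat.log 2 s.unpair.1 + 1) / 2 ^ s : ℕ) : ℝ) * 2 ^ s
      ≤ weight h s * 2 ^ (Nat.log 2 s.unpair.1 + 1) := by exact_mod_cast h₂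
  have h₄ : ((weight h s * 2 ^ (Nat.log 2 s.unpair.1 + 1) / 2 ^ s : ℕ) : ℝ)
      / 2 ^ (Nat.log 2 s.unpair.1 + 1) ≤ (weight h s : ℝ) / 2 ^ s := by
    rwa [div_le_div_iff₀ (by positivity) (by positivity)]
  rw [h₁, codeValue]
  push_cast at h₄ ⊢
  rw [add_assoc, add_div]
  norm_num at h₄ ⊢
  linarith

namespace Sparse

variable {h : ℕ → ℕ → ℕ}

theorem codeValue_lt (hh : Sparse h) {s : ℕ} (hs : Enters h s) :
    codeValue h s < 2 ^ (Nat.log 2 s.unpair.1 + 1) := by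
  have := (codeValue_add_one_le hs).trans (hh.weight_le (s + 1))
  rw [div_le_one (by positivity)] at this
  exact_mod_cast this

/-- Comparable codewords have nested dyadic intervals, whereas distinct events own disjoint ones. -/
theorem codeword_prefixFree (hh : Sparse h) {s s' : ℕ} (hs : Enters h s) (hs' : Enters h s')
    (hp : codeword h s <+: codeword h s') : s = s' := by
  have hv := eq_div_of_binary_prefix (hh.codeValue_lt hs) (hh.codeValue_lt hs') hp
  have hle : Nat.log 2 s.unpair.1 + 1 ≤ Nat.log 2 s'.unpair.1 + 1 := by
    simpa [codeword] using hp.length_le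
  generalize hℓ : Nat.log 2 s.unpair.1 + 1 = ℓ at *
  generalize hℓ' : Nat.log 2 s'.unpair.1 + 1 = ℓ' at *
  have hpow : (2 : ℝ) ^ ℓ' = 2 ^ ℓ * 2 ^ (ℓ' - ℓ) := by rw [← pow_add, Nat.add_sub_cancel' hle]
  have h₁ : (codeValue h s : ℝ) / 2 ^ ℓ ≤ codeValue h s' / 2 ^ ℓ' := by
    have : codeValue h s * 2 ^ (ℓ' - ℓ) ≤ codeValue h s' := hv ▸ Nat.div_mul_le_self _ _
    have : (codeValue h s : ℝ) * 2 ^ (ℓ' - ℓ) ≤ codeValue h s' := by exact_mod_cast this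
    rw [hpow, div_le_div_iff₀ (by positivity) (by positivity)]
    nlinarith [show (0 : ℝ) < 2 ^ ℓ by positivity]
  have h₂ : (codeValue h s' : ℝ) / 2 ^ ℓ' < (codeValue h s + 1) / 2 ^ ℓ := by
    have : codeValue h s' < 2 ^ (ℓ' - ℓ) * (codeValue h s + 1) :=
      hv ▸ Nat.lt_mul_div_succ _ (by positivity)
    have : (codeValue h s' : ℝ) < 2 ^ (ℓ' - ℓ) * (codeValue h s + 1) := by exact_mod_cast this
    rw [hpow, div_lt_div_iff₀ (by positivity) (by positivity)]
    nlinarith [show (0 : ℝ) < 2 ^ ℓ by positivity]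
  have a₁ := weight_lt_codeValue h s
  have a₂ := weight_lt_codeValue h s'
  have b₁ := codeValue_add_one_le hs
  have b₂ := codeValue_add_one_le hs'
  rw [hℓ] at a₁ b₁
  rw [hℓ'] at a₂ b₂
  have h₃ : (codeValue h s' : ℝ) / 2 ^ ℓ' < (codeValue h s' + 1) / 2 ^ ℓ' := by
    gcongr
    linarith
  rcases lt_trichotomy s s' with hlt | heq | hlt
  · have := weight_mono h (Nat.succ_le_of_lt hlt)
    simp only [Nat.succ_eq_add_one] at this
    linarith
  · exact heq
  · have := weight_mono h (Nat.succ_le_of_lt hlt)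
    simp only [Nat.succ_eq_add_one] at this
    linarith

end Sparse

/-! ### Growth of the number of nonrandom strings after an entering event -/

/-- The number of fresh strings that are compressed when the length `x` becomes `Large`. -/
def gap (a x : ℕ) : ℕ := 2 ^ (x - (2 * a + Nat.log 2 x + 4))

theorem primrec_gap : Primrec₂ gap :=
  primrec_two_pow.comp (Primrec.nat_sub.comp Primrec.snd (Primrec.nat_add.comp
    (Primrec.nat_add.comp (Primrec.nat_double.comp Primrec.fst) (primrec_log.comp Primrec.snd))
    (Primrec.const 4)))

/-- The graph of the machine that, at the entering event `s = (x, t)`, describes `gap a x` strings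
of length `x` not yet enumerated at stage `t` by codes of length `x - a - 2`. -/
def eventGraph (h : ℕ → ℕ → ℕ) (g : List Bool → ℕ → Bool) (p : ℕ × ℕ × ℕ) :
    Option (List Bool × List Bool) :=
  if Enters h p.2.1 ∧ 2 * p.1 + Nat.log 2 p.2.1.unpair.1 + 4 ≤ p.2.1.unpair.1 ∧
      p.2.2 < gap p.1 p.2.1.unpair.1 then
    (((allStrings p.2.1.unpair.1).filter fun σ => ¬ g σ p.2.1.unpair.2 = true)[p.2.2]?).map
      fun o => (List.replicate p.1 true ++ false :: (codeword h p.2.1 ++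
        binary (p.2.1.unpair.1 - (2 * p.1 + Nat.log 2 p.2.1.unpair.1 + 4)) p.2.2), o)
  else none

theorem primrec_eventGraph {h : ℕ → ℕ → ℕ} (hh : Primrec₂ h) {g : List Bool → ℕ → Bool}
    (hg : Primrec₂ g) : Primrec (eventGraph h g) := by
  have ha : Primrec fun p : ℕ × ℕ × ℕ => p.1 := Primrec.fst
  have hs : Primrec fun p : ℕ × ℕ × ℕ => p.2.1 := Primrec.fst.comp Primrec.snd
  have hi : Primrec fun p : ℕ × ℕ × ℕ => p.2.2 := Primrec.snd.comp Primrec.snd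
  have hx : Primrec fun p : ℕ × ℕ × ℕ => p.2.1.unpair.1 :=
    Primrec.fst.comp (Primrec.unpair.comp hs)
  have ht : Primrec fun p : ℕ × ℕ × ℕ => p.2.1.unpair.2 :=
    Primrec.snd.comp (Primrec.unpair.comp hs)
  have hb : Primrec fun p : ℕ × ℕ × ℕ => 2 * p.1 + Nat.log 2 p.2.1.unpair.1 + 4 :=
    Primrec.nat_add.comp (Primrec.nat_add.comp (Primrec.nat_double.comp ha)
      (primrec_log.comp hx)) (Primrec.const 4)
  have hR : PrimrecRel fun (σ : List Bool) (t : ℕ) => ¬ g σ t = true :=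
    PrimrecPred.not (Primrec.eq.comp hg (Primrec.const true))
  have hd : Primrec fun p : ℕ × ℕ × ℕ => List.replicate p.1 true ++ false :: (codeword h p.2.1 ++
      binary (p.2.1.unpair.1 - (2 * p.1 + Nat.log 2 p.2.1.unpair.1 + 4)) p.2.2) :=
    Primrec.list_append.comp ((primrec_replicate true).comp ha)
      (Primrec.list_cons.comp (Primrec.const false) (Primrec.list_append.comp
        ((primrec_codeword hh).comp hs) (primrec_binary.comp (Primrec.nat_sub.comp hx hb) hi)))
  refine Primrec.ite ?_ ?_ (Primrec.const none)
  · exact ((primrecPred_enters hh).comp hs).and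
      ((Primrec.nat_le.comp hb hx).and (Primrec.nat_lt.comp hi (primrec_gap.comp ha hx)))
  · refine Primrec.option_map (Primrec.list_getElem?.comp
      (hR.listFilter.comp (primrec_allStrings.comp hx) ht) hi) ?_
    exact Primrec.pair (hd.comp Primrec.fst) Primrec.snd

/-- The machine of `eventGraph` compresses `gap a x` strings not enumerated when x enters, and `U`
simulates it with loss c ≤ a. Applied to both machines with the same `h`, this makes one event
visible in both counts. -/
theorem exists_growth {h : ℕ → ℕ → ℕ} (hh : Sparse h) {g : List Bool → ℕ → Bool}
    {U : List Bool →. List Bool} (hg : Enumerates g U) (hU : IsUniversal U) :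
    ∃ c, ∀ a, c ≤ a → ∀ x t, 2 * a + Nat.log 2 x + 4 ≤ x → ¬ Large h x t →
      (∃ t, Large h x t) → count g x t + gap a x ≤ total U x := by
  classical
  obtain ⟨M, hM, hspec⟩ := exists_machine (eventGraph h g)
    (primrec_eventGraph hh.primrec hg.primrec).to_comp (by
      rintro ⟨a, s, i⟩ ⟨a', s', i'⟩ v o v' o' hp hp' hv
      simp only [eventGraph] at hp hp'
      split_ifs at hp hp' with hc hc'
      simp only [Option.map_eq_some_iff, Prod.mk.injEq] at hp hp'
      obtain ⟨o, ho, rfl, rfl⟩ := hp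
      obtain ⟨o', ho', rfl, rfl⟩ := hp'
      obtain ⟨rfl, hv⟩ := replicate_prefix hv
      obtain rfl : s = s' := by
        rcases List.prefix_or_prefix_of_prefix ((List.prefix_append _ _).trans hv)
          (List.prefix_append _ _) with hw | hw
        · exact hh.codeword_prefixFree hc.1 hc'.1 hw
        · exact (hh.codeword_prefixFree hc'.1 hc.1 hw).symm
      rw [List.prefix_append_right_inj] at hv
      obtain rfl := binary_injOn hc.2.2 hc'.2.2 (hv.eq_of_length (by simp))
      exact ⟨rfl, Option.some.inj (ho.symm.trans ho')⟩)
  obtain ⟨c, hc⟩ := hU.simulates M hM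
  refine ⟨c, fun a hca x t hx hl hex => ?_⟩
  obtain ⟨t', htt', hl₁, hl₂⟩ := hh.exists_enters hl hex
  refine (Nat.add_le_add_right (hg.count_mono x htt') _).trans ?_
  let L := (allStrings x).filter fun σ => ¬ g σ t' = true
  have hLlen : count g x t' + L.length = 2 ^ x := by
    have := List.length_eq_countP_add_countP (fun σ => g σ t') (l := allStrings x)
    rw [length_allStrings] at this
    rw [this, count, ← List.countP_eq_length_filter]
  -- At most half of the strings of length x are nonrandom, so enough fresh ones remain.
  have hlow : gap a x ≤ L.length := by
    have h₁ := two_mul_total_le hU.machine x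
    have h₂ := hg.count_le_total x t'
    have h₃ : 2 * gap a x ≤ 2 ^ x := by
      rw [gap, ← pow_succ']
      exact Nat.pow_le_pow_right (by norm_num) (by omega)
    omega
  have hnon : ∀ σ ∈ L.take (gap a x), σ ∉ randomStrings U := by
    intro σ hσ
    obtain ⟨i, hi, rfl⟩ := List.mem_iff_getElem.1 hσ
    rw [List.length_take, lt_min_iff] at hi
    rw [List.getElem_take]
    have hE : eventGraph h g (a, Nat.pair x t', i) = some (List.replicate a true ++ false ::
        (codeword h (Nat.pair x t') ++ binary (x - (2 * a + Nat.log 2 x + 4)) i), L[i]) := by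
      simp only [eventGraph, Nat.unpair_pair, Enters]
      rw [if_pos ⟨⟨hl₁, hl₂⟩, hx, hi.1⟩]
      change Option.map _ L[i]? = _
      rw [List.getElem?_eq_getElem hi.2]
      rfl
    obtain ⟨τ, hτ, hlen⟩ := hc _ _ (hspec _ _ _ hE)
    refine notMem_randomStrings.2 ⟨τ, hτ, ?_⟩
    have hLx : L[i].length = x :=
      mem_allStrings.1 (List.mem_of_mem_filter (List.getElem_mem hi.2))
    -- The code has length (a+1) + (log x + 1) + (x - 2a - log x - 4) = x - a - 2, so adding c ≤ a
    -- stays below x.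
    simp [codeword] at hlen
    omega
  have hnd : (L.take (gap a x)).Nodup :=
    ((nodup_allStrings x).filter _).sublist (List.take_sublist _ _)
  have hcard : (L.take (gap a x)).toFinset.card = gap a x := by
    rw [List.toFinset_card_of_nodup hnd, List.length_take, min_eq_left hlow]
  rw [count, total, countP_allStrings, countP_allStrings, ← hcard, ← Finset.card_union_of_disjoint]
  · refine Finset.card_le_card fun σ hσ => ?_
    simp only [Finset.mem_union, Finset.mem_filter, List.mem_toFinset, decide_eq_true_eq] at hσ ⊢
    rcases hσ with hσ | hσ
    · exact ⟨hσ.1, (hg.spec σ).1 ⟨_, hσ.2⟩⟩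
    · exact ⟨List.mem_of_mem_filter (List.mem_of_mem_take hσ), hnon σ hσ⟩
  · rw [Finset.disjoint_left]
    intro σ h₁ h₂
    simp only [Finset.mem_filter, List.mem_toFinset] at h₁ h₂
    have := (List.mem_filter.1 (List.mem_of_mem_take h₂)).2
    simp [h₁.2] at this

/-! ### Lengths found by a computable search -/

/-- From 1^a 0 y, with y of length x(a) - 2a - 2, a machine outputs y padded with zeros to length
x(a). This saves a + 1 bits, more than the simulation constant c ≤ a. As a determines the length of
y, the codes are prefix-free. -/
theorem exists_large_total {U : List Bool →. List Bool} (hU : IsUniversal U) {x : ℕ → ℕ}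
    (hx : Computable x) : ∃ c, ∀ a, c ≤ a → 2 * a + 2 ≤ x a →
      2 ^ (x a - (2 * a + 2)) ≤ total U (x a) := by
  classical
  let D : ℕ × List Bool → Option (List Bool × List Bool) := fun p =>
    if p.2.length + (2 * p.1 + 2) = x p.1 then
      some (List.replicate p.1 true ++ false :: p.2, p.2 ++ List.replicate (2 * p.1 + 2) false)
    else none
  have hD : Computable D := by
    have h₁ : Primrec fun q : (ℕ × List Bool) × ℕ =>
        if q.1.2.length + (2 * q.1.1 + 2) = q.2 then
          some (List.replicate q.1.1 true ++ false :: q.1.2,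
            q.1.2 ++ List.replicate (2 * q.1.1 + 2) false)
        else none := by
      have ha : Primrec fun q : (ℕ × List Bool) × ℕ => q.1.1 := Primrec.fst.comp Primrec.fst
      have hy : Primrec fun q : (ℕ × List Bool) × ℕ => q.1.2 := Primrec.snd.comp Primrec.fst
      have hb : Primrec fun q : (ℕ × List Bool) × ℕ => 2 * q.1.1 + 2 :=
        Primrec.nat_add.comp (Primrec.nat_double.comp ha) (Primrec.const 2)
      refine Primrec.ite (Primrec.eq.comp (Primrec.nat_add.comp (Primrec.list_length.comp hy) hb)
        Primrec.snd) (Primrec.option_some.comp (Primrec.pair ?_ ?_)) (Primrec.const none)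
      · exact Primrec.list_append.comp ((primrec_replicate true).comp ha)
          (Primrec.list_cons.comp (Primrec.const false) hy)
      · exact Primrec.list_append.comp hy ((primrec_replicate false).comp hb)
    exact h₁.to_comp.comp (Computable.id.pair (hx.comp Computable.fst))
  obtain ⟨M, hM, hspec⟩ := exists_machine D hD (by
    rintro ⟨a, y⟩ ⟨a', y'⟩ v o v' o' hp hp' hv
    simp only [D] at hp hp'
    split_ifs at hp hp' with hc hc'
    simp only [Option.some.injEq, Prod.mk.injEq] at hp hp'
    obtain ⟨rfl, rfl⟩ := hp
    obtain ⟨rfl, rfl⟩ := hp'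
    obtain ⟨rfl, hy⟩ := replicate_prefix hv
    obtain rfl := hy.eq_of_length (by omega)
    exact ⟨rfl, rfl⟩)
  obtain ⟨c, hc⟩ := hU.simulates M hM
  refine ⟨c, fun a hca hxa => ?_⟩
  have hinj : Function.Injective fun y : List Bool => y ++ List.replicate (2 * a + 2) false :=
    fun y y' hy => List.append_cancel_right hy
  rw [← length_allStrings, ← List.toFinset_card_of_nodup (nodup_allStrings _),
    ← Finset.card_image_of_injective _ hinj, total, countP_allStrings]
  refine Finset.card_le_card fun σ hσ => ?_
  simp only [Finset.mem_image, List.mem_toFinset, mem_allStrings] at hσ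
  obtain ⟨y, hy, rfl⟩ := hσ
  have hlen : (y ++ List.replicate (2 * a + 2) false).length = x a := by simp; omega
  simp only [Finset.mem_filter, List.mem_toFinset, mem_allStrings, decide_eq_true_eq, hlen,
    true_and]
  obtain ⟨τ, hτ, hτl⟩ := hc _ _ (hspec (a, y) _ _ (if_pos (by simp only; omega)))
  refine notMem_randomStrings.2 ⟨τ, hτ, ?_⟩
  simp at hτl
  rw [hlen]
  omega

/-! ### Auxiliary facts on computability -/

theorem exists_computable_search {b : ℕ → ℕ → Bool} (hb : Computable₂ b)
    (h : ∀ a, ∃ n, b a n = true) : ∃ f : ℕ → ℕ, Computable f ∧ ∀ a, b a (f a) = true :=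
  ⟨fun a => Nat.find (h a),
    Computable.find (P := fun a n => b a n = true)
      (ComputablePred.computable_iff.2 ⟨fun p => b p.1 p.2, hb, rfl⟩) h,
    fun a => Nat.find_spec (h a)⟩

theorem rePred_exists {R : ℕ → ℕ → Prop} (hR : PrimrecRel R) : REPred fun z => ∃ n, R z n := by
  classical
  have hp : Computable₂ fun z n => decide (R z n) := (PrimrecRel.decide hR).to_comp
  refine (Partrec.rfind hp.partrec₂).dom_re.of_eq fun z => ?_
  refine (Nat.rfind_dom' (p := fun n => Part.some (decide (R z n)))).trans ?_
  constructor
  · rintro ⟨n, hn, -⟩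
    exact ⟨n, by simpa using hn⟩
  · rintro ⟨n, hn⟩
    exact ⟨n, by simpa using hn, fun _ => trivial⟩

/-- Query every string of length x(z); the accepting rows are those with at least m(z) negative
answers. -/
theorem ttReducible_of_total {U : List Bool →. List Bool} {A : Set ℕ} {C : ℕ → Prop}
    {x m : ℕ → ℕ} (hC : PrimrecPred C) (hx : Primrec x) (hm : Primrec m)
    (hA : ∀ z, z ∈ A ↔ C z ∧ m z ≤ total U (x z)) : TTReducible A (randomStrings U) := by
  classical
  have hcount : Primrec fun r : List Bool => r.countP fun b => decide (b = false) := by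
    have hR : PrimrecRel fun (b : Bool) (_ : Unit) => b = false :=
      Primrec.eq.comp Primrec.fst (Primrec.const false)
    refine (Primrec.list_length.comp (hR.listFilter.comp Primrec.id (Primrec.const ()))).of_eq
      fun r => ?_
    rw [List.countP_eq_length_filter]
    rfl
  have hR : PrimrecRel fun (r : List Bool) (k : ℕ) => k ≤ r.countP fun b => decide (b = false) :=
    Primrec.nat_le.comp Primrec.snd (hcount.comp Primrec.fst)
  refine ⟨fun z => allStrings (x z), fun z => if C z then (allStrings (2 ^ x z)).filter
    fun r => m z ≤ r.countP fun b => decide (b = false) else [], ?_, ?_, fun z => ?_⟩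
  · exact (primrec_allStrings.comp hx).to_comp
  · exact (Primrec.ite hC (hR.listFilter.comp
      (primrec_allStrings.comp (primrec_two_pow.comp hx)) hm) (Primrec.const [])).to_comp
  · rw [hA]
    beta_reduce
    split_ifs with h
    · simp only [h, true_and, List.mem_filter, mem_allStrings, List.length_map, length_allStrings,
        decide_eq_true_eq, List.countP_map, total]
      refine iff_of_eq (congrArg _ (congrArg (fun p => List.countP p _) (funext fun σ => ?_)))
      simp
    · simp [h]

/-! ### The level of a length -/

/-- Take the least q for which the eventual bound holds; failure of the bound for q - 1 is the
frequent lower bound. -/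
theorem exists_level {P : ℕ → Prop} (hP : ∃ᶠ x in atTop, P x) {T d : ℕ → ℕ} {B : ℕ}
    (hB : ∀ᶠ x in atTop, P x → T x < B * d x) :
    ∃ q, (∃ᶠ x in atTop, P x ∧ q * d x ≤ T x) ∧ ∀ᶠ x in atTop, P x → T x < (q + 1) * d x := by
  classical
  have hex : ∃ q, ∀ᶠ x in atTop, P x → T x < (q + 1) * d x :=
    ⟨B, hB.mono fun x hx hPx => (hx hPx).trans_le (Nat.mul_le_mul_right _ (Nat.le_succ B))⟩
  refine ⟨Nat.find hex, ?_, Nat.find_spec hex⟩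
  rcases hq : Nat.find hex with _ | q
  · exact hP.mono fun x hx => ⟨hx, by simp⟩
  · have := Nat.find_min hex (show q < Nat.find hex by omega)
    rw [not_eventually] at this
    exact this.mono fun x hx => by simpa using hx

theorem eventually_log_add_le (k : ℕ) : ∀ᶠ x in atTop, k + Nat.log 2 x ≤ x := by
  filter_upwards [eventually_ge_atTop (2 * k + 1)] with x hx
  have h₁ : 2 ^ Nat.log 2 x ≤ x := Nat.pow_log_le_self 2 (by omega)
  rcases hJ : Nat.log 2 x with _ | J
  · omega
  · rw [hJ, pow_succ] at h₁
    have : J < 2 ^ J := Nat.lt_two_pow_self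
    omega

theorem total_lt_mul_gap {T a x : ℕ} (hx : 2 * a + Nat.log 2 x + 4 ≤ x)
    (hT : T * 2 ^ Nat.log 2 x < 2 ^ (x + 4)) : T < 2 ^ (2 * a + 8) * gap a x := by
  have : 2 ^ (2 * a + 8) * gap a x * 2 ^ Nat.log 2 x = 2 ^ (x + 4) := by
    rw [gap, ← pow_add, ← pow_add]
    congr 1
    omega
  rw [← this] at hT
  exact lt_of_mul_lt_mul_right hT (Nat.zero_le _)

/-! ### The common lower bound -/

theorem exists_common_lower_bound {U₁ U₂ : List Bool →. List Bool}
    (hU₁ : IsUniversal U₁) (hU₂ : IsUniversal U₂) :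
    ∃ A : Set ℕ, REPred (fun n => n ∈ A) ∧ ¬ ComputablePred (fun n => n ∈ A) ∧
      TTReducible A (randomStrings U₁) ∧ TTReducible A (randomStrings U₂) := by
  classical
  obtain ⟨g₁, p₁, m₁, z₁, s₁⟩ := exists_stages hU₁.machine.partrec
  obtain ⟨g₂, p₂, m₂, z₂, s₂⟩ := exists_stages hU₂.machine.partrec
  have hg₁ : Enumerates g₁ U₁ := ⟨p₁, m₁, z₁, s₁⟩
  have hg₂ : Enumerates g₂ U₂ := ⟨p₂, m₂, z₂, s₂⟩
  have hh := sparse_add hg₁ hg₂ hU₁.machine hU₂.machine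
  obtain ⟨c₁, hc₁⟩ := exists_growth hh hg₁ hU₁
  obtain ⟨c₂, hc₂⟩ := exists_growth hh hg₂ hU₂
  let a := max c₁ c₂
  replace hc₁ := hc₁ a (le_max_left _ _)
  replace hc₂ := hc₂ a (le_max_right _ _)
  let h : ℕ → ℕ → ℕ := fun x t => count g₁ x t + count g₂ x t
  change Sparse h at hh
  let T : ℕ → ℕ := fun x => total U₁ x + total U₂ x
  let P : ℕ → Prop := fun x => ∀ t, ¬ Large h x t
  have hlim : ∀ x, ∃ t, h x t = T x := fun x => by
    obtain ⟨t₁, h₁⟩ := hg₁.exists_count_eq_total x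
    obtain ⟨t₂, h₂⟩ := hg₂.exists_count_eq_total x
    exact ⟨max t₁ t₂, congrArg₂ _ (h₁ _ (le_max_left _ _)) (h₂ _ (le_max_right _ _))⟩
  have hPT : ∀ x, P x → T x * 2 ^ Nat.log 2 x < 2 ^ (x + 4) := fun x hx => by
    obtain ⟨t, ht⟩ := hlim x
    have := hx t
    rwa [Large, not_le, ht] at this
  have hPfreq : ∃ᶠ x in atTop, P x := by
    refine frequently_atTop.2 fun n => ?_
    obtain ⟨x, hx, hxP⟩ := hh.exists_not_large n
    refine ⟨x, ?_, hxP⟩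
    rw [← hx]
    exact Nat.log_le_self 2 x
  have hlarge : ∀ᶠ x in atTop, 2 * a + Nat.log 2 x + 4 ≤ x :=
    (eventually_log_add_le (2 * a + 4)).mono fun x hx => by omega
  -- The level q is found nonconstructively, but it is a single number and A may depend on it.
  obtain ⟨q, hq, hq'⟩ := exists_level hPfreq (T := T) (d := gap a)
    (hlarge.mono fun x hx hPx => total_lt_mul_gap hx (hPT x hPx))
  obtain ⟨x₁, hx₁⟩ := eventually_atTop.1 (hlarge.and hq')
  let C : ℕ → Prop := fun z => x₁ ≤ z.unpair.1 ∧ ¬ Large h z.unpair.1 z.unpair.2 ∧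
    q * gap a z.unpair.1 ≤ h z.unpair.1 z.unpair.2
  have hX : Primrec fun z : ℕ => z.unpair.1 := Primrec.fst.comp Primrec.unpair
  have hS : Primrec fun z : ℕ => z.unpair.2 := Primrec.snd.comp Primrec.unpair
  have hG : Primrec fun z : ℕ => gap a z.unpair.1 := primrec_gap.comp (Primrec.const a) hX
  have hC : PrimrecPred C :=
    (Primrec.nat_le.comp (Primrec.const x₁) hX).and
      ((((primrecRel_large hh.primrec).comp hX hS).not).and
        (Primrec.nat_le.comp (Primrec.nat_mul.comp (Primrec.const q) hG)
          (hh.primrec.comp hX hS)))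
  have hCT : ∀ z, C z → P z.unpair.1 → T z.unpair.1 < h z.unpair.1 z.unpair.2 + gap a z.unpair.1 :=
    fun z hz hP => ((hx₁ _ hz.1).2 hP).trans_le (by
      rw [add_mul, one_mul]
      exact Nat.add_le_add_right hz.2.2 _)
  let A : Set ℕ := {z | C z ∧ ∃ t, Large h z.unpair.1 t}
  have hA₁ : ∀ z, z ∈ A ↔
      C z ∧ count g₁ z.unpair.1 z.unpair.2 + gap a z.unpair.1 ≤ total U₁ z.unpair.1 := fun z => by
    refine and_congr_right fun hz => ⟨hc₁ _ _ (hx₁ _ hz.1).1 hz.2.1, fun hle => ?_⟩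
    -- If x never becomes `Large`, the combined count grows by less than a gap after stage t. The
    -- other count cannot decrease, so this one grows by less than a gap too.
    by_contra hcon
    have := hCT z hz (not_exists.1 hcon)
    have := hg₂.count_le_total z.unpair.1 z.unpair.2
    simp only [T, h] at *
    omega
  have hA₂ : ∀ z, z ∈ A ↔
      C z ∧ count g₂ z.unpair.1 z.unpair.2 + gap a z.unpair.1 ≤ total U₂ z.unpair.1 := fun z => by
    refine and_congr_right fun hz => ⟨hc₂ _ _ (hx₁ _ hz.1).1 hz.2.1, fun hle => ?_⟩
    by_contra hcon
    have := hCT z hz (not_exists.1 hcon)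
    have := hg₁.count_le_total z.unpair.1 z.unpair.2
    simp only [T, h] at *
    omega
  refine ⟨A, ?_, ?_, ?_, ?_⟩
  · have hR : PrimrecRel fun z t : ℕ => C z ∧ Large h z.unpair.1 t :=
      (hC.comp Primrec.fst).and
        ((primrecRel_large hh.primrec).comp (hX.comp Primrec.fst) Primrec.snd)
    exact (rePred_exists hR).of_eq fun z => exists_and_left
  · intro hcomp
    obtain ⟨f, hf, hfA⟩ := ComputablePred.computable_iff.1 hcomp
    have hfA' : ∀ z, z ∈ A ↔ f z = true := fun z => iff_of_eq (congrFun hfA z)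
    let b : ℕ → ℕ → Bool := fun k z =>
      decide (C z ∧ 2 * k + 6 ≤ Nat.log 2 z.unpair.1) && !f z
    have hb : Computable₂ b := by
      have h₁ : PrimrecRel fun k z : ℕ => C z ∧ 2 * k + 6 ≤ Nat.log 2 z.unpair.1 :=
        (hC.comp Primrec.snd).and (Primrec.nat_le.comp
          (Primrec.nat_add.comp (Primrec.nat_double.comp Primrec.fst) (Primrec.const 6))
          (primrec_log.comp (hX.comp Primrec.snd)))
      exact Primrec.and.to_comp.comp (PrimrecRel.decide h₁).to_comp
        (Primrec.not.to_comp.comp (hf.comp Computable.snd))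
    have hex : ∀ k, ∃ z, b k z = true := fun k => by
      -- Take a never-`Large` length at level q and a stage at which its combined count is final.
      obtain ⟨x, ⟨hPx, hqx⟩, hx, hxk⟩ := (hq.and_eventually
        ((eventually_ge_atTop x₁).and (eventually_ge_atTop (2 ^ (2 * k + 6))))).exists
      obtain ⟨t, ht⟩ := hlim x
      have hlog : 2 * k + 6 ≤ Nat.log 2 x :=
        Nat.le_log_of_pow_le (by norm_num) hxk
      have hnot : f (Nat.pair x t) = false := by
        rw [← Bool.not_eq_true, ← hfA']
        rintro ⟨-, t', ht'⟩
        rw [Nat.unpair_pair] at ht'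
        exact hPx t' ht'
      refine ⟨Nat.pair x t, ?_⟩
      simp only [b, hnot, C, Nat.unpair_pair, ht, Bool.not_false, Bool.and_true,
        decide_eq_true_eq]
      exact ⟨⟨hx, hPx t, hqx⟩, hlog⟩
    obtain ⟨z, hz, hbz⟩ := exists_computable_search hb hex
    obtain ⟨c, hc⟩ := exists_large_total hU₁ (hX.to_comp.comp hz)
    -- The search is evaluated at its own simulation constant.
    have hzc := hbz c
    simp only [b, Bool.and_eq_true, decide_eq_true_eq, Bool.not_eq_true'] at hzc
    obtain ⟨⟨hCz, hlog⟩, hfz⟩ := hzc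
    have hPz : P (z c).unpair.1 := by
      intro t ht
      rw [(hfA' _).1 ⟨hCz, t, ht⟩] at hfz
      exact absurd hfz (by simp)
    have hlog' := Nat.log_le_self 2 (z c).unpair.1
    have hle := hc c le_rfl (by omega)
    have hlt := hPT _ hPz
    refine absurd hlt (not_lt.2 ?_)
    -- The search condition log x ≥ 2c + 6 makes the 2^(x - 2c - 2) compressible strings reach the
    -- `Large` threshold.
    calc 2 ^ ((z c).unpair.1 + 4)
        ≤ 2 ^ ((z c).unpair.1 - (2 * c + 2) + Nat.log 2 (z c).unpair.1) :=
          Nat.pow_le_pow_right (by norm_num) (by omega)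
      _ = 2 ^ ((z c).unpair.1 - (2 * c + 2)) * 2 ^ Nat.log 2 (z c).unpair.1 := pow_add _ _ _
      _ ≤ _ := Nat.mul_le_mul_right _ (hle.trans (Nat.le_add_right _ _))
  · exact ttReducible_of_total hC hX
      (Primrec.nat_add.comp ((primrec_count p₁).comp hX hS) hG) hA₁
  · exact ttReducible_of_total hC hX
      (Primrec.nat_add.comp ((primrec_count p₂).comp hX hS) hG) hA₂

end RandomStrings

theorem mainTheorem2 (U₁ U₂ : List Bool →. List Bool)
    (hU₁ : RandomStrings.IsUniversal U₁) (hU₂ : RandomStrings.IsUniversal U₂) :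
    (∃ A : Set ℕ, REPred (fun n => n ∈ A) ∧ ¬ ComputablePred (fun n => n ∈ A) ∧
      RandomStrings.TTReducible A (RandomStrings.randomStrings U₁) ∧
      RandomStrings.TTReducible A (RandomStrings.randomStrings U₂)) ∧
    ¬ RandomStrings.TTMinimalPair (RandomStrings.randomStrings U₁)
      (RandomStrings.randomStrings U₂) := by
  have h := RandomStrings.exists_common_lower_bound hU₁ hU₂
  refine ⟨h, fun hmin => ?_⟩
  obtain ⟨A, -, hA, h₁, h₂⟩ := h
  exact hA (hmin.2.2 A h₁ h₂)
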